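/- Let $n \ge 1$, let $(a_{i,j})_{1\le i,j\le n}$ be an array of non-negative real numbers, let $\Pi_n$ be a uniformly distributed random permutation of $\{1,\dots,n\}$, defined on some probability space, and let $$Z_n = \sum_{i=1}^n a_{i,\Pi_n(i)}.$$ Then, for all $t>0$, $$\mathbb{P}\left(|Z_n-\mathbb{E}[Z_n]|\ge t\right)\le 8e^{1/16}\exp\left(\frac{-t^2}{16\left(4\,\frac1n\sum_{i,j=1}^n a_{i,j}^2+2\max_{1\le i,j\le n}\{a_{i,j}\}\,t\right)}\right),$$ where, if all $a_{i,j}$ are $0$ (so that the denominator vanishes), the right-hand side is read as $0$. Moreover $$\frac1n\sum_{i,j=1}^n a_{i,j}^2\le \max_{1\le i,j\le n}\{a_{i,j}\}\;\mathbb{E}[Z_n],$$ so that, up to the numerical constants, the bound above is at least as sharp as Chatterjee's bound $2\exp\left(-t^2/\left(4\max_{i,j}\{a_{i,j}\}\,\mathbb{E}[Z_n]+2\max_{i,j}\{a_{i,j}\}\,t\right)\right)$ for the same probability. -/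

import Mathlib

open MeasureTheory

/-- `X` is a uniform random permutation of the `n`-element set `Fin n`: a random variable on `(Ω, P)`
(for the discrete σ-algebra on permutations) that takes each of the `n!` values with
probability `1 / n!`. -/
structure IsUniformPermutation {Ω : Type*} [MeasurableSpace Ω] (P : Measure Ω) {n : ℕ}
    (X : Ω → Equiv.Perm (Fin n)) : Prop where
  measurableSet_fiber : ∀ σ : Equiv.Perm (Fin n), MeasurableSet (X ⁻¹' {σ})
  prob_fiber : ∀ σ : Equiv.Perm (Fin n), P (X ⁻¹' {σ}) = ((n.factorial : ℕ) : ENNReal)⁻¹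

/-- The permuted sum `∑ i, a i (σ i)` of the array `a` along the permutation `σ`. -/
def permutedSum {n : ℕ} (a : Fin n → Fin n → ℝ) (σ : Equiv.Perm (Fin n)) : ℝ :=
  ∑ i, a i (σ i)

/-- The largest entry of the array `a` (a maximum, since `n` is positive). -/
noncomputable def maxEntry {n : ℕ} [NeZero n] (a : Fin n → Fin n → ℝ) : ℝ :=
  (Finset.univ : Finset (Fin n × Fin n)).sup' Finset.univ_nonempty fun p => a p.1 p.2

/-- The normalized sum of squares `(1 / n) ∑ i, ∑ j, (a i j)²` of the array `a`. -/
noncomputable def meanSquare {n : ℕ} (a : Fin n → Fin n → ℝ) : ℝ :=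
  (1 / (n : ℝ)) * ∑ i, ∑ j, (a i j) ^ 2

/-! This is Stein's method of exchangeable pairs, the pair being `σ` and `σ * Equiv.swap i j`.
Averaging the increments over `i, j` returns the centered sum Y, so summation by parts
(`sum_centeredSum_mul`) with g = exp(θY) bounds the derivative of m(θ) = ∑ exp(θY) by 4θ ∑ (v + W)
exp(θY), where v is the mean square and W the permuted sum of squares. W is random, and bounding it
by its maximum would lose the dependence on v. Instead, the squared array is self-bounding (b² ≤
M²b), so the same inequality controls the exponential moments of W. Gibbs duality then transfers
this control to W under the weight exp(θY). Integrating the resulting differential inequality and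
applying Chernoff's bound to `a` and `-a` gives 2 exp(-t²/(48v + 16Mt)), which is stronger than
required. -/

/-- The permuted sum minus its average `(1 / n) ∑ i, ∑ j, a i j` over all permutations. -/
noncomputable def centeredSum {n : ℕ} (a : Fin n → Fin n → ℝ) (σ : Equiv.Perm (Fin n)) : ℝ :=
  permutedSum a σ - (1 / (n : ℝ)) * ∑ i, ∑ j, a i j

/-! ### Transpositions and summation by parts -/

theorem permutedSum_sub_mul_swap {n : ℕ} (a : Fin n → Fin n → ℝ) (σ : Equiv.Perm (Fin n))
    (i j : Fin n) :
    permutedSum a σ - permutedSum a (σ * Equiv.swap i j) =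
      a i (σ i) + a j (σ j) - a i (σ j) - a j (σ i) := by
  unfold permutedSum
  rw [← Finset.sum_sub_distrib]
  by_cases hij : i = j
  · subst hij
    simp
  · rw [← Finset.sum_subset (Finset.subset_univ {i, j}), Finset.sum_pair hij]
    · simp
      ring
    · intro k _ hk
      simp only [Finset.mem_insert, Finset.mem_singleton, not_or] at hk
      simp [Equiv.swap_apply_of_ne_of_ne hk.1 hk.2]

theorem sum_sum_apply_perm {n : ℕ} (a : Fin n → Fin n → ℝ) (σ : Equiv.Perm (Fin n)) :
    ∑ i, ∑ j, a i (σ j) = ∑ i, ∑ j, a i j :=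
  Finset.sum_congr rfl fun i _ => Equiv.sum_comp σ (a i)

theorem sum_sum_four_terms {n : ℕ} (a : Fin n → Fin n → ℝ) (σ : Equiv.Perm (Fin n)) (c : ℝ) :
    ∑ i, ∑ j, (a i (σ i) + a j (σ j) + c * (a i (σ j) + a j (σ i))) =
      2 * n * permutedSum a σ + 2 * c * ∑ i, ∑ j, a i j := by
  have h : ∑ i, ∑ j, a j (σ i) = ∑ i, ∑ j, a i j := by
    rw [Finset.sum_comm, sum_sum_apply_perm]
  simp only [Finset.sum_add_distrib, ← Finset.mul_sum, sum_sum_apply_perm, h]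
  simp only [permutedSum, Finset.sum_const, Finset.card_univ, Fintype.card_fin, nsmul_eq_mul,
    ← Finset.mul_sum]
  ring

theorem sum_sum_sub_mul_swap {n : ℕ} [NeZero n] (a : Fin n → Fin n → ℝ)
    (σ : Equiv.Perm (Fin n)) :
    ∑ i, ∑ j, (permutedSum a σ - permutedSum a (σ * Equiv.swap i j)) =
      2 * n * centeredSum a σ := by
  have hn : (n : ℝ) ≠ 0 := Nat.cast_ne_zero.mpr (NeZero.ne n)
  have h := sum_sum_four_terms a σ (-1)
  have h' : ∑ i, ∑ j, (permutedSum a σ - permutedSum a (σ * Equiv.swap i j)) =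
      ∑ i, ∑ j, (a i (σ i) + a j (σ j) + (-1) * (a i (σ j) + a j (σ i))) := by
    refine Finset.sum_congr rfl fun i _ => Finset.sum_congr rfl fun j _ => ?_
    rw [permutedSum_sub_mul_swap]
    ring
  rw [h', h, centeredSum]
  field_simp
  ring

theorem sum_sum_sub_mul_swap_sq_le {n : ℕ} [NeZero n] (a : Fin n → Fin n → ℝ)
    (σ : Equiv.Perm (Fin n)) :
    ∑ i, ∑ j, (permutedSum a σ - permutedSum a (σ * Equiv.swap i j)) ^ 2 ≤
      8 * n * (meanSquare a + permutedSum (fun i j => a i j ^ 2) σ) := by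
  have hn : (n : ℝ) ≠ 0 := Nat.cast_ne_zero.mpr (NeZero.ne n)
  have h := sum_sum_four_terms (fun i j => a i j ^ 2) σ 1
  calc _ ≤ ∑ i, ∑ j, 4 * (a i (σ i) ^ 2 + a j (σ j) ^ 2 +
        1 * (a i (σ j) ^ 2 + a j (σ i) ^ 2)) := by
        refine Finset.sum_le_sum fun i _ => Finset.sum_le_sum fun j _ => ?_
        rw [permutedSum_sub_mul_swap]
        -- Cauchy–Schwarz on four terms: (p + q - r - s)² ≤ 4(p² + q² + r² + s²).
        nlinarith [sq_nonneg (a i (σ i) - a j (σ j)), sq_nonneg (a i (σ i) + a i (σ j)),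
          sq_nonneg (a i (σ i) + a j (σ i)), sq_nonneg (a j (σ j) + a i (σ j)),
          sq_nonneg (a j (σ j) + a j (σ i)), sq_nonneg (a i (σ j) - a j (σ i))]
    _ = _ := by
        simp only [← Finset.mul_sum]
        rw [h, meanSquare]
        field_simp
        ring

theorem sum_mul_swap {n : ℕ} (i j : Fin n) (g : Equiv.Perm (Fin n) → ℝ) :
    ∑ σ, g (σ * Equiv.swap i j) = ∑ σ, g σ :=
  Equiv.sum_comp (Equiv.mulRight (Equiv.swap i j)) g

/-- The increment changes sign under the involution `σ ↦ σ * Equiv.swap i j`, so symmetrizing the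
sum doubles it and replaces g by its increment. -/
theorem sum_centeredSum_mul {n : ℕ} [NeZero n] (a : Fin n → Fin n → ℝ)
    (g : Equiv.Perm (Fin n) → ℝ) :
    4 * n * ∑ σ, centeredSum a σ * g σ =
      ∑ i, ∑ j, ∑ σ, (permutedSum a σ - permutedSum a (σ * Equiv.swap i j)) *
        (g σ - g (σ * Equiv.swap i j)) := by
  have h1 : 2 * n * ∑ σ, centeredSum a σ * g σ =
      ∑ i, ∑ j, ∑ σ, (permutedSum a σ - permutedSum a (σ * Equiv.swap i j)) * g σ := by
    calc _ = ∑ σ, (∑ i, ∑ j, (permutedSum a σ - permutedSum a (σ * Equiv.swap i j))) * g σ := by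
          rw [Finset.mul_sum]
          refine Finset.sum_congr rfl fun σ _ => ?_
          rw [sum_sum_sub_mul_swap]
          ring
      _ = _ := by
          simp only [Finset.sum_mul]
          rw [Finset.sum_comm]
          exact Finset.sum_congr rfl fun i _ => Finset.sum_comm
  have h2 : ∀ i j : Fin n, ∑ σ, (permutedSum a σ - permutedSum a (σ * Equiv.swap i j)) *
        (g σ - g (σ * Equiv.swap i j)) =
      2 * ∑ σ, (permutedSum a σ - permutedSum a (σ * Equiv.swap i j)) * g σ := by
    intro i j
    have h3 := sum_mul_swap i j
      (fun σ => (permutedSum a σ - permutedSum a (σ * Equiv.swap i j)) * g σ)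
    simp only [mul_assoc, Equiv.swap_mul_self, mul_one] at h3
    rw [two_mul]
    nth_rewrite 2 [← h3]
    rw [← Finset.sum_add_distrib]
    refine Finset.sum_congr rfl fun σ _ => ?_
    ring
  simp only [h2, ← Finset.mul_sum]
  rw [← h1]
  ring

theorem sum_centeredSum {n : ℕ} [NeZero n] (a : Fin n → Fin n → ℝ) :
    ∑ σ, centeredSum a σ = 0 := by
  have hn : (n : ℝ) ≠ 0 := Nat.cast_ne_zero.mpr (NeZero.ne n)
  have h := sum_centeredSum_mul a (fun _ => 1)
  simpa [hn] using h

/-! ### Differential inequalities for exponential moments -/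

theorem sub_mul_exp_sub_exp_le {θ : ℝ} (hθ : 0 ≤ θ) (x y : ℝ) :
    (x - y) * (Real.exp (θ * x) - Real.exp (θ * y)) ≤
      θ * (x - y) ^ 2 * (Real.exp (θ * x) + Real.exp (θ * y)) := by
  wlog hxy : y ≤ x generalizing x y
  · have := this y x (le_of_not_ge hxy)
    nlinarith
  have h1 : Real.exp (θ * x) - Real.exp (θ * y) ≤ θ * (x - y) * Real.exp (θ * x) := by
    have h2 := Real.add_one_le_exp (θ * y - θ * x)
    have h3 : Real.exp (θ * y) = Real.exp (θ * y - θ * x) * Real.exp (θ * x) := by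
      rw [← Real.exp_add]
      congr 1
      ring
    nlinarith [Real.exp_pos (θ * x)]
  have h4 : 0 ≤ θ * (x - y) ^ 2 * Real.exp (θ * y) := by positivity
  nlinarith [mul_le_mul_of_nonneg_left h1 (sub_nonneg.mpr hxy)]

theorem sum_centeredSum_mul_exp_le {n : ℕ} [NeZero n] (a : Fin n → Fin n → ℝ) {θ : ℝ}
    (hθ : 0 ≤ θ) :
    ∑ σ, centeredSum a σ * Real.exp (θ * centeredSum a σ) ≤
      4 * θ * ∑ σ, (meanSquare a + permutedSum (fun i j => a i j ^ 2) σ) *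
        Real.exp (θ * centeredSum a σ) := by
  have hn : (0 : ℝ) < n := Nat.cast_pos.mpr (NeZero.pos n)
  set e : Equiv.Perm (Fin n) → ℝ := fun σ => Real.exp (θ * centeredSum a σ) with he
  have h1 : ∀ i j : Fin n, ∑ σ, (permutedSum a σ - permutedSum a (σ * Equiv.swap i j)) *
        (e σ - e (σ * Equiv.swap i j)) ≤
      2 * θ * ∑ σ, (permutedSum a σ - permutedSum a (σ * Equiv.swap i j)) ^ 2 * e σ := by
    intro i j
    have h3 := sum_mul_swap i j
      (fun σ => (permutedSum a σ - permutedSum a (σ * Equiv.swap i j)) ^ 2 * e σ)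
    simp only [mul_assoc, Equiv.swap_mul_self, mul_one] at h3
    calc _ ≤ ∑ σ, (θ * ((permutedSum a σ - permutedSum a (σ * Equiv.swap i j)) ^ 2 * e σ) +
          θ * ((permutedSum a (σ * Equiv.swap i j) - permutedSum a σ) ^ 2 *
            e (σ * Equiv.swap i j))) := by
          refine Finset.sum_le_sum fun σ _ => ?_
          have := sub_mul_exp_sub_exp_le hθ (centeredSum a σ)
            (centeredSum a (σ * Equiv.swap i j))
          have h5 : centeredSum a σ - centeredSum a (σ * Equiv.swap i j) =
            permutedSum a σ - permutedSum a (σ * Equiv.swap i j) := by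
            simp [centeredSum]
          rw [h5] at this
          refine this.trans (le_of_eq ?_)
          simp only [he]
          ring
      _ = _ := by
          rw [Finset.sum_add_distrib, ← Finset.mul_sum, ← Finset.mul_sum, h3]
          ring
  have h2 : 4 * n * ∑ σ, centeredSum a σ * e σ ≤
      2 * θ * ∑ σ, (8 * n * (meanSquare a + permutedSum (fun i j => a i j ^ 2) σ)) * e σ := by
    rw [sum_centeredSum_mul]
    calc _ ≤ ∑ i, ∑ j, 2 * θ *
          ∑ σ, (permutedSum a σ - permutedSum a (σ * Equiv.swap i j)) ^ 2 * e σ :=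
          Finset.sum_le_sum fun i _ => Finset.sum_le_sum fun j _ => h1 i j
      _ = 2 * θ * ∑ σ,
          (∑ i, ∑ j, (permutedSum a σ - permutedSum a (σ * Equiv.swap i j)) ^ 2) * e σ := by
          simp only [Finset.sum_mul, ← Finset.mul_sum]
          congr 1
          conv_rhs => rw [Finset.sum_comm]
          exact Finset.sum_congr rfl fun i _ => Finset.sum_comm
      _ ≤ _ := by
          refine mul_le_mul_of_nonneg_left (Finset.sum_le_sum fun σ _ => ?_) (by positivity)
          exact mul_le_mul_of_nonneg_right (sum_sum_sub_mul_swap_sq_le a σ) (Real.exp_pos _).le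
  simp only [mul_assoc, ← Finset.mul_sum] at h2 ⊢
  nlinarith

/-- Grönwall: m(s) exp(-Ks²) is nonincreasing on [0, T]. -/
theorem le_mul_exp_of_deriv_le {m m' : ℝ → ℝ} {K T : ℝ} (hm : ∀ s, HasDerivAt m (m' s) s)
    (hT : 0 ≤ T) (h : ∀ s ∈ Set.Icc 0 T, m' s ≤ 2 * K * s * m s) :
    m T ≤ m 0 * Real.exp (K * T ^ 2) := by
  have hd : ∀ s, HasDerivAt (fun s => m s * Real.exp (-(K * s ^ 2)))
      (m' s * Real.exp (-(K * s ^ 2)) +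
        m s * (Real.exp (-(K * s ^ 2)) * (-(K * (2 * s))))) s := by
    intro s
    have h2 : HasDerivAt (fun s : ℝ => -(K * s ^ 2)) (-(K * (2 * s))) s := by
      simpa using ((hasDerivAt_pow 2 s).const_mul K).fun_neg
    exact (hm s).mul h2.exp
  have hanti : AntitoneOn (fun s => m s * Real.exp (-(K * s ^ 2))) (Set.Icc 0 T) := by
    refine antitoneOn_of_deriv_nonpos (convex_Icc 0 T)
      (fun s _ => (hd s).continuousAt.continuousWithinAt)
      (fun s _ => (hd s).differentiableAt.differentiableWithinAt) fun s hs => ?_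
    rw [(hd s).deriv]
    nlinarith [h s (interior_subset hs), Real.exp_pos (-(K * s ^ 2))]
  have h0 := hanti (Set.left_mem_Icc.mpr hT) (Set.right_mem_Icc.mpr hT) hT
  simp only [Real.exp_neg] at h0
  norm_num at h0
  rwa [← div_eq_mul_inv, div_le_iff₀ (Real.exp_pos _)] at h0

theorem hasDerivAt_sum_exp {ι : Type*} [Fintype ι] (f : ι → ℝ) (s : ℝ) :
    HasDerivAt (fun s => ∑ k, Real.exp (s * f k)) (∑ k, f k * Real.exp (s * f k)) s := by
  refine HasDerivAt.fun_sum fun k _ => ?_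
  simpa [mul_comm] using ((hasDerivAt_id s).mul_const (f k)).exp

theorem meanSquare_nonneg {n : ℕ} (a : Fin n → Fin n → ℝ) : 0 ≤ meanSquare a := by
  unfold meanSquare
  positivity

theorem centeredSum_sq {n : ℕ} (a : Fin n → Fin n → ℝ) (σ : Equiv.Perm (Fin n)) :
    centeredSum (fun i j => a i j ^ 2) σ =
      permutedSum (fun i j => a i j ^ 2) σ - meanSquare a :=
  rfl

theorem sum_exp_mul_permutedSum_sq_le {n : ℕ} [NeZero n] (a : Fin n → Fin n → ℝ) {M : ℝ}
    (hM : ∀ i j, a i j ^ 2 ≤ M ^ 2) {l : ℝ} (hl : 0 ≤ l) (hlM : 8 * l * M ^ 2 ≤ 1) :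
    ∑ σ, Real.exp (l * permutedSum (fun i j => a i j ^ 2) σ) ≤
      n.factorial * Real.exp (2 * l * meanSquare a) := by
  set b : Fin n → Fin n → ℝ := fun i j => a i j ^ 2 with hb
  have hv := meanSquare_nonneg a
  have hsq : ∀ i j, b i j ^ 2 ≤ M ^ 2 * b i j := fun i j => by
    rw [sq (b i j)]
    exact mul_le_mul_of_nonneg_right (hM i j) (sq_nonneg _)
  have hvb : meanSquare b ≤ M ^ 2 * meanSquare a := by
    have : ∑ i, ∑ j, b i j ^ 2 ≤ M ^ 2 * ∑ i, ∑ j, b i j := by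
      simp only [Finset.mul_sum]
      exact Finset.sum_le_sum fun i _ => Finset.sum_le_sum fun j _ => hsq i j
    calc _ ≤ (1 / (n : ℝ)) * (M ^ 2 * ∑ i, ∑ j, b i j) :=
          mul_le_mul_of_nonneg_left this (by positivity)
      _ = _ := by
          simp only [meanSquare, hb]
          ring
  have hW : ∀ σ, permutedSum (fun i j => b i j ^ 2) σ ≤ M ^ 2 * permutedSum b σ := fun σ => by
    simp only [permutedSum, Finset.mul_sum]
    exact Finset.sum_le_sum fun i _ => hsq _ _
  have hderiv : ∀ s ∈ Set.Icc 0 l,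
      ∑ σ, centeredSum b σ * Real.exp (s * centeredSum b σ) ≤
        2 * (8 * M ^ 2 * meanSquare a) * s * ∑ σ, Real.exp (s * centeredSum b σ) := by
    intro s hs
    set m := ∑ σ, Real.exp (s * centeredSum b σ) with hm
    set m' := ∑ σ, centeredSum b σ * Real.exp (s * centeredSum b σ) with hm'
    have hm0 : 0 ≤ m := Finset.sum_nonneg fun σ _ => (Real.exp_pos _).le
    have hsM : s * M ^ 2 ≤ l * M ^ 2 := mul_le_mul_of_nonneg_right hs.2 (sq_nonneg M)
    have hs0 := hs.1
    have h1 : m' ≤ 4 * s * (M ^ 2 * (m' + 2 * meanSquare a * m)) := by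
      refine (sum_centeredSum_mul_exp_le b hs.1).trans ?_
      refine mul_le_mul_of_nonneg_left ?_ (by positivity)
      rw [hm, hm', Finset.mul_sum, ← Finset.sum_add_distrib, Finset.mul_sum]
      refine Finset.sum_le_sum fun σ _ => ?_
      rw [← add_mul, ← mul_assoc]
      refine mul_le_mul_of_nonneg_right ?_ (Real.exp_pos _).le
      rw [hb, centeredSum_sq, ← hb]
      linarith [hW σ]
    have h2 : 0 ≤ s * M ^ 2 * meanSquare a * m := by positivity
    -- Since 4sM² ≤ 1/2, the term in m' on the right of `h1` is absorbed when m' ≥ 0; otherwise the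
    -- claim is trivial.
    by_cases h3 : 0 ≤ m'
    · nlinarith
    · nlinarith
  have h := le_mul_exp_of_deriv_le (fun s => hasDerivAt_sum_exp (centeredSum b) s) hl hderiv
  simp only [zero_mul, Real.exp_zero, Finset.sum_const, Finset.card_univ, Fintype.card_perm,
    Fintype.card_fin, nsmul_eq_mul, mul_one] at h
  calc _ = Real.exp (l * meanSquare a) * ∑ σ, Real.exp (l * centeredSum b σ) := by
        rw [Finset.mul_sum]
        refine Finset.sum_congr rfl fun σ _ => ?_
        rw [← Real.exp_add, hb, centeredSum_sq]
        congr 1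
        ring
    _ ≤ Real.exp (l * meanSquare a) *
        (n.factorial * Real.exp (8 * M ^ 2 * meanSquare a * l ^ 2)) :=
        mul_le_mul_of_nonneg_left h (Real.exp_pos _).le
    _ = n.factorial * Real.exp (l * meanSquare a + 8 * M ^ 2 * meanSquare a * l ^ 2) := by
        rw [Real.exp_add]
        ring
    _ ≤ _ := by
        refine mul_le_mul_of_nonneg_left (Real.exp_le_exp.mpr ?_) (by positivity)
        nlinarith [mul_nonneg hl hv]

/-- Only squares of entries are bounded, with no sign condition, so that the result also serves `-a`
for the lower tail. -/
theorem sum_exp_mul_centeredSum_le {n : ℕ} [NeZero n] (a : Fin n → Fin n → ℝ) {M : ℝ}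
    (hM0 : 0 < M) (hM : ∀ i j, a i j ^ 2 ≤ M ^ 2) {θ : ℝ} (hθ : 0 ≤ θ) (hθM : 8 * θ * M ≤ 1) :
    ∑ σ, Real.exp (θ * centeredSum a σ) ≤
      n.factorial * Real.exp (12 * meanSquare a * θ ^ 2) := by
  have hv := meanSquare_nonneg a
  have hl : 8 * (1 / (8 * M ^ 2)) * M ^ 2 = 1 := by
    field_simp
  have hl0 : 0 < 1 / (8 * M ^ 2) := by positivity
  have hS := sum_exp_mul_permutedSum_sq_le a hM hl0.le hl.le
  set l := 1 / (8 * M ^ 2) with hldef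
  have hderiv : ∀ s ∈ Set.Icc 0 θ,
      ∑ σ, centeredSum a σ * Real.exp (s * centeredSum a σ) ≤
        2 * (12 * meanSquare a) * s * ∑ σ, Real.exp (s * centeredSum a σ) := by
    intro s hs
    have hs0 := hs.1
    have h1 := sum_centeredSum_mul_exp_le a hs.1
    simp only [add_mul, Finset.sum_add_distrib, ← Finset.mul_sum] at h1
    -- Jensen, as Y has mean zero; it lets n! be replaced by m in `hgibbs`.
    have hmge : (n.factorial : ℝ) ≤ ∑ σ, Real.exp (s * centeredSum a σ) := by
      have : ∑ σ : Equiv.Perm (Fin n), (s * centeredSum a σ + 1) = n.factorial := by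
        rw [Finset.sum_add_distrib, ← Finset.mul_sum, sum_centeredSum]
        simp [Fintype.card_perm]
      rw [← this]
      exact Finset.sum_le_sum fun σ _ => Real.add_one_le_exp _
    have hm'0 : 0 ≤ ∑ σ, centeredSum a σ * Real.exp (s * centeredSum a σ) := by
      rw [← sum_centeredSum a]
      refine Finset.sum_le_sum fun σ _ => ?_
      rcases le_total 0 (centeredSum a σ) with h | h
      · exact le_mul_of_one_le_right h (Real.one_le_exp (mul_nonneg hs0 h))
      · have : Real.exp (s * centeredSum a σ) ≤ 1 :=
          Real.exp_le_one_iff.mpr (mul_nonpos_of_nonneg_of_nonpos hs0 h)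
        nlinarith
    -- Gibbs duality, obtained from u + 1 ≤ exp u at u = lW - sY - 2lv. The shift 2lv normalizes the
    -- exponential moment of W.
    have hgibbs : l * ∑ σ, permutedSum (fun i j => a i j ^ 2) σ *
          Real.exp (s * centeredSum a σ) ≤
        s * (∑ σ, centeredSum a σ * Real.exp (s * centeredSum a σ)) +
          2 * l * meanSquare a * ∑ σ, Real.exp (s * centeredSum a σ) := by
      have hpt : ∀ σ, l * (permutedSum (fun i j => a i j ^ 2) σ *
          Real.exp (s * centeredSum a σ)) ≤
          s * (centeredSum a σ * Real.exp (s * centeredSum a σ)) +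
          2 * l * meanSquare a * Real.exp (s * centeredSum a σ) +
          (Real.exp (-(2 * l * meanSquare a)) *
            Real.exp (l * permutedSum (fun i j => a i j ^ 2) σ) -
              Real.exp (s * centeredSum a σ)) := by
        intro σ
        have h2 := Real.add_one_le_exp (l * permutedSum (fun i j => a i j ^ 2) σ -
          s * centeredSum a σ - 2 * l * meanSquare a)
        have h3 : Real.exp (-(2 * l * meanSquare a)) *
            Real.exp (l * permutedSum (fun i j => a i j ^ 2) σ) =
            Real.exp (l * permutedSum (fun i j => a i j ^ 2) σ -
              s * centeredSum a σ - 2 * l * meanSquare a) * Real.exp (s * centeredSum a σ) := by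
          rw [← Real.exp_add, ← Real.exp_add]
          congr 1
          ring
        rw [h3]
        nlinarith [mul_le_mul_of_nonneg_right h2 (Real.exp_pos (s * centeredSum a σ)).le]
      have hsum := Finset.sum_le_sum fun σ (_ : σ ∈ Finset.univ) => hpt σ
      simp only [Finset.sum_add_distrib, Finset.sum_sub_distrib, ← Finset.mul_sum] at hsum
      have h4 : Real.exp (-(2 * l * meanSquare a)) *
          ∑ σ, Real.exp (l * permutedSum (fun i j => a i j ^ 2) σ) ≤ n.factorial := by
        rw [Real.exp_neg, inv_mul_le_iff₀ (Real.exp_pos _), mul_comm]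
        exact hS
      linarith
    set m := ∑ σ, Real.exp (s * centeredSum a σ)
    set m' := ∑ σ, centeredSum a σ * Real.exp (s * centeredSum a σ)
    set w := ∑ σ, permutedSum (fun i j => a i j ^ 2) σ * Real.exp (s * centeredSum a σ)
    have hw : w ≤ 8 * M ^ 2 * s * m' + 2 * meanSquare a * m := by
      have h5 := mul_le_mul_of_nonneg_left hgibbs (by positivity : 0 ≤ 8 * M ^ 2)
      have h6 : 8 * M ^ 2 * l = 1 := by linarith
      calc w = 8 * M ^ 2 * l * w := by rw [h6, one_mul]
        _ = 8 * M ^ 2 * (l * w) := by ring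
        _ ≤ _ := h5
        _ = 8 * M ^ 2 * s * m' + 2 * (8 * M ^ 2 * l) * meanSquare a * m := by ring
        _ = _ := by rw [h6, mul_one]
    have hsM : s * M ≤ 1 / 8 := by nlinarith [mul_le_mul_of_nonneg_right hs.2 hM0.le]
    have hsM2 : (s * M) ^ 2 ≤ (1 / 8) ^ 2 := by
      have : 0 ≤ s * M := by positivity
      gcongr
    have h7 := mul_le_mul_of_nonneg_left hw (by positivity : 0 ≤ 4 * s)
    have h8 := mul_le_mul_of_nonneg_right hsM2 hm'0
    -- m' ≤ 12svm + 32(sM)²m', and 32(sM)² ≤ 1/2, so m' ≤ 24svm.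
    nlinarith
  have h := le_mul_exp_of_deriv_le (fun s => hasDerivAt_sum_exp (centeredSum a) s) hθ hderiv
  simpa [Fintype.card_perm] using h

/-! ### Tail bounds for the random permutation -/

theorem integral_comp_uniformPermutation {Ω : Type*} [MeasurableSpace Ω] {P : Measure Ω}
    [IsProbabilityMeasure P] {n : ℕ} {X : Ω → Equiv.Perm (Fin n)}
    (hX : IsUniformPermutation P X) (g : Equiv.Perm (Fin n) → ℝ) :
    Integrable (fun ω => g (X ω)) P ∧
      ∫ ω, g (X ω) ∂P = (∑ σ, g σ) / n.factorial := by
  have hg : (fun ω => g (X ω)) =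
      fun ω => ∑ σ, (X ⁻¹' {σ}).indicator (fun _ => g σ) ω := by
    funext ω
    rw [Finset.sum_eq_single (X ω)]
    · exact (Set.indicator_of_mem (Set.mem_singleton (X ω)) _).symm
    · intro σ _ hσ
      exact Set.indicator_of_notMem (fun h => hσ h.symm) _
    · simp
  have hint : ∀ σ ∈ (Finset.univ : Finset (Equiv.Perm (Fin n))),
      Integrable ((X ⁻¹' {σ}).indicator fun _ => g σ) P := fun σ _ =>
    (integrable_const _).indicator (hX.measurableSet_fiber σ)
  rw [hg]
  refine ⟨integrable_finsetSum _ hint, ?_⟩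
  rw [integral_finsetSum _ hint, Finset.sum_div]
  refine Finset.sum_congr rfl fun σ _ => ?_
  rw [integral_indicator_const _ (hX.measurableSet_fiber σ), Measure.real, hX.prob_fiber]
  simp [div_eq_inv_mul]

theorem measureReal_le_centeredSum {Ω : Type*} [MeasurableSpace Ω] {P : Measure Ω}
    [IsProbabilityMeasure P] {n : ℕ} [NeZero n] {X : Ω → Equiv.Perm (Fin n)}
    (hX : IsUniformPermutation P X) (a : Fin n → Fin n → ℝ) {M : ℝ}
    (hM0 : 0 < M) (hM : ∀ i j, a i j ^ 2 ≤ M ^ 2) {t : ℝ} (ht : 0 < t) :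
    P.real {ω | t ≤ centeredSum a (X ω)} ≤
      Real.exp (-t ^ 2 / (2 * (24 * meanSquare a + 8 * M * t))) := by
  have hv := meanSquare_nonneg a
  have hD : 0 < 24 * meanSquare a + 8 * M * t := by positivity
  set D := 24 * meanSquare a + 8 * M * t with hDdef
  -- The Chernoff parameter t/D satisfies 8θM ≤ 1, and 24v ≤ D makes the exponent at most -t²/(2D).
  have hθ : 0 ≤ t / D := by positivity
  have hθM : 8 * (t / D) * M ≤ 1 := by
    rw [show 8 * (t / D) * M = 8 * M * t / D by ring, div_le_one hD]
    linarith
  have hN : (0 : ℝ) < n.factorial := Nat.cast_pos.mpr n.factorial_pos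
  obtain ⟨hi, he⟩ :=
    integral_comp_uniformPermutation hX (fun σ => Real.exp (t / D * centeredSum a σ))
  calc _ ≤ Real.exp (-(t / D) * t) *
        ProbabilityTheory.mgf (fun ω => centeredSum a (X ω)) P (t / D) :=
        ProbabilityTheory.measure_ge_le_exp_mul_mgf t hθ hi
    _ ≤ Real.exp (-(t / D) * t) * Real.exp (12 * meanSquare a * (t / D) ^ 2) := by
        refine mul_le_mul_of_nonneg_left ?_ (Real.exp_pos _).le
        rw [ProbabilityTheory.mgf, he, div_le_iff₀ hN, mul_comm]
        exact sum_exp_mul_centeredSum_le a hM0 hM hθ hθM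
    _ ≤ _ := by
        rw [← Real.exp_add, Real.exp_le_exp]
        have h1 : -(t / D) * t + 12 * meanSquare a * (t / D) ^ 2 =
            (-(2 * D) + 24 * meanSquare a) * t ^ 2 / (2 * D ^ 2) := by
          field_simp
          ring
        have h2 : -t ^ 2 / (2 * D) = -D * t ^ 2 / (2 * D ^ 2) := by
          field_simp
        rw [h1, h2]
        gcongr
        have : 0 ≤ 8 * M * t := by positivity
        linarith

theorem integral_permutedSum {Ω : Type*} [MeasurableSpace Ω] {P : Measure Ω}
    [IsProbabilityMeasure P] {n : ℕ} [NeZero n] {X : Ω → Equiv.Perm (Fin n)}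
    (hX : IsUniformPermutation P X) (a : Fin n → Fin n → ℝ) :
    ∫ ω, permutedSum a (X ω) ∂P = (1 / (n : ℝ)) * ∑ i, ∑ j, a i j := by
  have hN : (n.factorial : ℝ) ≠ 0 := Nat.cast_ne_zero.mpr n.factorial_ne_zero
  rw [(integral_comp_uniformPermutation hX (permutedSum a)).2, div_eq_iff hN]
  have h := sum_centeredSum a
  simp only [centeredSum, Finset.sum_sub_distrib, Finset.sum_const, Finset.card_univ,
    Fintype.card_perm, Fintype.card_fin, nsmul_eq_mul] at h
  linarith

theorem centeredSum_neg {n : ℕ} (a : Fin n → Fin n → ℝ) (σ : Equiv.Perm (Fin n)) :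
    centeredSum (fun i j => -a i j) σ = -centeredSum a σ := by
  simp only [centeredSum, permutedSum, Finset.sum_neg_distrib]
  ring

theorem le_maxEntry {n : ℕ} [NeZero n] (a : Fin n → Fin n → ℝ) (i j : Fin n) :
    a i j ≤ maxEntry a :=
  Finset.le_sup' (fun p : Fin n × Fin n => a p.1 p.2) (Finset.mem_univ (i, j))

theorem measureReal_le_abs_centeredSum {Ω : Type*} [MeasurableSpace Ω] {P : Measure Ω}
    [IsProbabilityMeasure P] {n : ℕ} [NeZero n] {X : Ω → Equiv.Perm (Fin n)}
    (hX : IsUniformPermutation P X) (a : Fin n → Fin n → ℝ) {M : ℝ}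
    (hM0 : 0 < M) (hM : ∀ i j, a i j ^ 2 ≤ M ^ 2) {t : ℝ} (ht : 0 < t) :
    P.real {ω | t ≤ |centeredSum a (X ω)|} ≤
      2 * Real.exp (-t ^ 2 / (2 * (24 * meanSquare a + 8 * M * t))) := by
  have h1 := measureReal_le_centeredSum hX a hM0 hM ht
  have h2 := measureReal_le_centeredSum hX (fun i j => -a i j) hM0 (by simpa using hM) ht
  have h3 : meanSquare (fun i j => -a i j) = meanSquare a := by simp [meanSquare]
  simp only [centeredSum_neg, h3] at h2
  have h4 : {ω | t ≤ |centeredSum a (X ω)|} =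
      {ω | t ≤ centeredSum a (X ω)} ∪ {ω | t ≤ -centeredSum a (X ω)} := by
    ext ω
    simp [le_abs]
  rw [h4]
  linarith [measureReal_union_le (μ := P) {ω | t ≤ centeredSum a (X ω)}
    {ω | t ≤ -centeredSum a (X ω)}]

theorem corollary2p1 {Ω : Type*} [MeasurableSpace Ω] (P : Measure Ω) [IsProbabilityMeasure P]
    {n : ℕ} [NeZero n] (a : Fin n → Fin n → ℝ) (ha : ∀ i j, 0 ≤ a i j)
    (X : Ω → Equiv.Perm (Fin n)) (hX : IsUniformPermutation P X) :
    (∀ t : ℝ, 0 < t →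
      P.real {ω | t ≤ |permutedSum a (X ω) - ∫ ω', permutedSum a (X ω') ∂P|} ≤
          8 * Real.exp (1 / 16) *
            Real.exp (-t ^ 2 / (16 * (4 * meanSquare a + 2 * maxEntry a * t))) ∧
      ((∀ i j, a i j = 0) →
        P.real {ω | t ≤ |permutedSum a (X ω) - ∫ ω', permutedSum a (X ω') ∂P|} = 0)) ∧
    meanSquare a ≤ maxEntry a * ∫ ω, permutedSum a (X ω) ∂P := by
  rw [integral_permutedSum hX a]
  have hM := le_maxEntry a
  refine ⟨fun t ht => ?_, ?_⟩
  · have hzero : (∀ i j, a i j = 0) →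
        P.real {ω | t ≤ |permutedSum a (X ω) - (1 / (n : ℝ)) * ∑ i, ∑ j, a i j|} = 0 := by
      intro h
      simp [permutedSum, h, ht.not_ge]
    refine ⟨?_, hzero⟩
    by_cases hM0 : 0 < maxEntry a
    · have hsq : ∀ i j, a i j ^ 2 ≤ maxEntry a ^ 2 := fun i j =>
        pow_le_pow_left₀ (ha i j) (hM i j) 2
      refine (measureReal_le_abs_centeredSum hX a hM0 hsq ht).trans ?_
      have hv := meanSquare_nonneg a
      refine mul_le_mul ?_ (Real.exp_le_exp.mpr ?_) (Real.exp_pos _).le (by positivity)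
      · linarith [Real.one_le_exp (by norm_num : (0 : ℝ) ≤ 1 / 16)]
      · rw [neg_div, neg_div, neg_le_neg_iff]
        have h5 : 0 < maxEntry a * t := mul_pos hM0 ht
        refine div_le_div_of_nonneg_left (sq_nonneg t) ?_ ?_ <;> nlinarith
    -- All entries vanish here, so the probability is zero. Division by zero makes the Lean
    -- exponential 1, hence the separate clause of the statement.
    · rw [hzero fun i j => le_antisymm ((hM i j).trans (not_lt.mp hM0)) (ha i j)]
      positivity
  · rw [meanSquare, mul_left_comm]
    refine mul_le_mul_of_nonneg_left ?_ (by positivity)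
    simp only [Finset.mul_sum]
    refine Finset.sum_le_sum fun i _ => Finset.sum_le_sum fun j _ => ?_
    rw [sq]
    exact mul_le_mul_of_nonneg_right (hM i j) (ha i j)
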